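/- Call a function $f:\mathbb R^d\to\mathbb R$ *DC* if $f=g-h$ for some convex functions $g,h:\mathbb R^d\to\mathbb R$. Call a set $P\subset\mathbb R^2$ a *DC graph* if it is the image, under a rotation of $\mathbb R^2$ about the origin, of a set $\{(x,f(x)) : x\in[a,b]\}$, where $f:\mathbb R\to\mathbb R$ is a DC function and $a\le b$ are real numbers. A family $(P_i)_{i\in I}$ of subsets of $\mathbb R^2$ is *locally finite* if each point of $\mathbb R^2$ has a neighbourhood that meets $P_i$ for only finitely many $i\in I$. **Proposition.** Let $A\subset\mathbb R^2$ be the union of a locally finite family of DC graphs. Then either $A=\varnothing$, or $A$ is a nonempty closed set and its Euclidean distance function $d_A(x)=\inf_{a\in A}|x-a|$ is a DC function on $\mathbb R^2$. -/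

import Mathlib

/-- A real function on a real vector space is DC if it is the difference of two convex functions
(both defined on the whole space). -/
def IsDC {E : Type*} [AddCommGroup E] [Module ℝ E] (f : E → ℝ) : Prop :=
  ∃ g h : E → ℝ, ConvexOn ℝ Set.univ g ∧ ConvexOn ℝ Set.univ h ∧ ∀ x, f x = g x - h x

/-- The graph of `f` restricted to `I`, as a subset of the Euclidean plane. -/
def planarGraphOn (f : ℝ → ℝ) (I : Set ℝ) : Set (EuclideanSpace ℝ (Fin 2)) :=
  {p | p 0 ∈ I ∧ p 1 = f (p 0)}

/-- The rotation of the Euclidean plane by the angle `θ` about the origin. -/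
noncomputable def planarRotation (θ : ℝ) (p : EuclideanSpace ℝ (Fin 2)) :
    EuclideanSpace ℝ (Fin 2) :=
  !₂[Real.cos θ * p 0 - Real.sin θ * p 1, Real.sin θ * p 0 + Real.cos θ * p 1]

/-- A DC graph is a rotated copy of the graph of `f` restricted to `[a, b]`, where `f : ℝ → ℝ` is
a DC function and `[a, b]` is a nonempty compact interval, possibly a single point. -/
def IsDCGraph (P : Set (EuclideanSpace ℝ (Fin 2))) : Prop :=
  ∃ (f : ℝ → ℝ) (a b θ : ℝ), IsDC f ∧ a ≤ b ∧
    P = planarRotation θ '' planarGraphOn f (Set.Icc a b)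

/-- The system of subsets of `ℝ ^ d` consisting of the empty set and of all nonempty closed sets
whose (Euclidean) distance function is DC. -/
def dcDistanceSets (d : ℕ) : Set (Set (EuclideanSpace ℝ (Fin d))) :=
  {∅} ∪ {A | A.Nonempty ∧ IsClosed A ∧ IsDC fun x => Metric.infDist x A}

/-! It suffices to find a convex `H` with `H - d_A` convex. For continuous functions convexity may
be tested by the midpoint inequality for small increments at each point. This test suits distance
functions: if `d ≤ δ` near `x` with equality at `x`, then midconvexity of `H - δ` at `x` passes to
`H - d` (`LocallyMidconvexAt.of_touching`), so only one nearest point has to be examined.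

For the graph of `f = g - k` over `[a, b]`, inscribe polygons. Off a polygon, a nearest point inside
a side makes the distance locally dominated by a linear function. At an interior vertex `p`, the
vector `x - p` lies in the normal cone of the corner, whose directions are close to plus or minus
the normal of a side. There the norm need not be compensated by itself: a lens function, which grows
only at a rate comparable to the change of slope, is enough. The changes of slope of a difference of
convex functions have bounded total, so the controls are bounded pointwise independently of the
partition and have a convex limit. The two endpoints are handled by adding the distances to them.

On the graph itself the limit gives nothing, but `d(y) ≤ |y 1 - f (y 0)|`, and `2 max(u, v) - |u -
v| = u + v` with `u = y 1 + k (y 0)`, `v = g (y 0)` supplies a convex compensation.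

A locally finite union is treated by touching again: near each point finitely many pieces matter,
and their convex controls, cut off near the origin, are summed over growing radii. -/

open Filter Topology

/-! ### Local midpoint convexity -/

/-- `φ` satisfies the midpoint inequality at `x` for all sufficiently small increments. -/
def LocallyMidconvexAt {E : Type*} [NormedAddCommGroup E] (φ : E → ℝ) (x : E) : Prop :=
  ∀ᶠ v in 𝓝 (0 : E), 2 * φ x ≤ φ (x + v) + φ (x - v)

namespace LocallyMidconvexAt

variable {E : Type*} [NormedAddCommGroup E] {φ ψ : E → ℝ} {x : E}

theorem add (hφ : LocallyMidconvexAt φ x) (hψ : LocallyMidconvexAt ψ x) :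
    LocallyMidconvexAt (fun y => φ y + ψ y) x := by
  filter_upwards [hφ, hψ] with v h1 h2
  linarith

theorem congr (hφ : LocallyMidconvexAt φ x) (h : ∀ y, φ y = ψ y) : LocallyMidconvexAt ψ x := by
  rwa [← funext h]

/-- Raising the values around `x` while keeping the value at `x` only helps the midpoint inequality.
With `φ = H - δ` and `ψ = H - d`, this replaces a distance function `d` by any local upper bound `δ`
that is exact at `x`. -/
theorem of_touching (hφ : LocallyMidconvexAt φ x) (hx : φ x = ψ x)
    (hle : ∀ᶠ y in 𝓝 x, φ y ≤ ψ y) : LocallyMidconvexAt ψ x := by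
  have h1 : Tendsto (fun v : E => x + v) (𝓝 0) (𝓝 x) :=
    Continuous.tendsto' (by fun_prop) _ _ (add_zero x)
  have h2 : Tendsto (fun v : E => x - v) (𝓝 0) (𝓝 x) :=
    Continuous.tendsto' (by fun_prop) _ _ (sub_zero x)
  filter_upwards [hφ, h1.eventually hle, h2.eventually hle] with v h h3 h4
  linarith

variable [NormedSpace ℝ E]

theorem of_convexOn {s : Set E} (hφ : ConvexOn ℝ s φ) (hs : s ∈ 𝓝 x) :
    LocallyMidconvexAt φ x := by
  have h1 : Tendsto (fun v : E => x + v) (𝓝 0) (𝓝 x) :=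
    Continuous.tendsto' (by fun_prop) _ _ (add_zero x)
  have h2 : Tendsto (fun v : E => x - v) (𝓝 0) (𝓝 x) :=
    Continuous.tendsto' (by fun_prop) _ _ (sub_zero x)
  filter_upwards [h1.eventually hs, h2.eventually hs] with v h3 h4
  have h := hφ.2 h3 h4 (by norm_num : (0 : ℝ) ≤ 1 / 2) (by norm_num : (0 : ℝ) ≤ 1 / 2)
    (by norm_num)
  have h5 : (1 / 2 : ℝ) • (x + v) + (1 / 2 : ℝ) • (x - v) = x := by module
  rw [h5] at h
  simp only [smul_eq_mul] at h
  linarith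

theorem of_convexOn_univ (hφ : ConvexOn ℝ Set.univ φ) : LocallyMidconvexAt φ x :=
  of_convexOn hφ univ_mem

end LocallyMidconvexAt

/-- A continuous function that is locally midpoint convex at every point of a convex set is convex
on this set. -/
theorem convexOn_of_locallyMidconvexAt {E : Type*} [NormedAddCommGroup E] [NormedSpace ℝ E]
    {s : Set E} (hs : Convex ℝ s) {φ : E → ℝ} (hφ : ContinuousOn φ s)
    (h : ∀ x ∈ s, LocallyMidconvexAt φ x) : ConvexOn ℝ s φ := by
  refine ⟨hs, fun x hx y hy a b ha hb hab => ?_⟩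
  set γ : ℝ → E := fun t => x + t • (y - x) with hγ
  have hγs : ∀ t ∈ Set.Icc (0 : ℝ) 1, γ t ∈ s := fun t ht => hs.add_smul_sub_mem hx hy ht
  have hγc : Continuous γ := by fun_prop
  set ψ : ℝ → ℝ := fun t => φ (γ t) - (φ x + t * (φ y - φ x)) with hψ
  have hψc : ContinuousOn ψ (Set.Icc 0 1) :=
    (hφ.comp hγc.continuousOn hγs).sub (by fun_prop)
  have key : ∀ t ∈ Set.Icc (0 : ℝ) 1, ψ t ≤ 0 := by
    by_contra! hcon
    obtain ⟨t₁, ht₁, hpos⟩ := hcon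
    obtain ⟨T, hT, hmax⟩ := isCompact_Icc.exists_isMaxOn ⟨t₁, ht₁⟩ hψc
    have hM : 0 < ψ T := hpos.trans_le (hmax ht₁)
    have hZ : IsCompact (Set.Icc (0 : ℝ) 1 ∩ ψ ⁻¹' {ψ T}) :=
      isCompact_Icc.of_isClosed_subset
        (hψc.preimage_isClosed_of_isClosed isClosed_Icc isClosed_singleton) Set.inter_subset_left
    -- Take the leftmost maximum point of the excess over the chord: the midpoint inequality there
    -- makes `t₀ - ε` a maximum point too.
    obtain ⟨t₀, ⟨ht₀, hψt₀⟩, hleast⟩ := hZ.exists_isLeast ⟨T, hT, rfl⟩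
    have hψt₀ : ψ t₀ = ψ T := hψt₀
    have h0 : ψ 0 = 0 := by simp [hψ, hγ]
    have h1 : ψ 1 = 0 := by simp [hψ, hγ]
    have hlt0 : 0 < t₀ := lt_of_le_of_ne ht₀.1 (by rintro rfl; linarith)
    have hlt1 : t₀ < 1 := lt_of_le_of_ne ht₀.2 (by rintro rfl; linarith)
    have htend : Tendsto (fun ε : ℝ => ε • (y - x)) (𝓝[>] 0) (𝓝 0) := by
      have : Tendsto (fun ε : ℝ => ε • (y - x)) (𝓝 0) (𝓝 ((0 : ℝ) • (y - x))) :=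
        (by fun_prop : Continuous fun ε : ℝ => ε • (y - x)).tendsto 0
      rw [zero_smul] at this
      exact this.mono_left nhdsWithin_le_nhds
    have hev := htend.eventually (h (γ t₀) (hγs t₀ ht₀))
    have hsmall : ∀ᶠ ε : ℝ in 𝓝[>] 0, ε < min t₀ (1 - t₀) :=
      nhdsWithin_le_nhds (gt_mem_nhds (lt_min hlt0 (by linarith)))
    obtain ⟨ε, ⟨hε1, hε2⟩, hε0⟩ := ((hev.and hsmall).and self_mem_nhdsWithin).exists
    have hε0 : 0 < ε := hε0
    have e1 : ε < t₀ := hε2.trans_le (min_le_left _ _)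
    have e2 : ε < 1 - t₀ := hε2.trans_le (min_le_right _ _)
    have g1 : γ t₀ + ε • (y - x) = γ (t₀ + ε) := by simp only [hγ]; module
    have g2 : γ t₀ - ε • (y - x) = γ (t₀ - ε) := by simp only [hγ]; module
    rw [g1, g2] at hε1
    have m1 : ψ (t₀ + ε) ≤ ψ T := hmax ⟨by linarith, by linarith⟩
    have m2 : ψ (t₀ - ε) ≤ ψ T := hmax ⟨by linarith, by linarith⟩
    have hsum : 2 * ψ t₀ ≤ ψ (t₀ + ε) + ψ (t₀ - ε) := by
      simp only [hψ]; linarith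
    have m3 : ψ (t₀ - ε) = ψ T := by linarith
    have := hleast ⟨⟨by linarith, by linarith⟩, m3⟩
    linarith
  have hb' := key b ⟨hb, by linarith⟩
  have e : γ b = a • x + b • y := by
    have : a = 1 - b := by linarith
    rw [this]; simp only [hγ]; module
  simp only [hψ] at hb'
  rw [e] at hb'
  have : a = 1 - b := by linarith
  simp only [smul_eq_mul]
  rw [this] at hb' ⊢
  linarith

/-- A function is DC as soon as some convex function dominates its convex part. -/
theorem isDC_of_convexOn_sub {E : Type*} [AddCommGroup E] [Module ℝ E] {d H : E → ℝ}
    (hH : ConvexOn ℝ Set.univ H) (hd : ConvexOn ℝ Set.univ fun x => H x - d x) : IsDC d :=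
  ⟨H, fun x => H x - d x, hH, hd, fun x => by ring⟩

/-! ### Lens functions -/

section Lens

variable {E : Type*} [NormedAddCommGroup E] [InnerProductSpace ℝ E]

/-- The support function, translated by `-ν`, of the intersection of the unit ball with the ball of
radius `r` about `ν`. -/
noncomputable def lensSupport (ν : E) (r : ℝ) (x : E) : ℝ :=
  ⨆ u : {u : E // ‖u‖ ≤ 1 ∧ ‖u - ν‖ ≤ r}, inner ℝ x ((u : E) - ν)

variable {ν : E} {r : ℝ}

theorem inner_sub_le_of_norm_sub_le {u : E} (hu : ‖u - ν‖ ≤ r) (x : E) :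
    inner ℝ x (u - ν) ≤ r * ‖x‖ :=
  (real_inner_le_norm _ _).trans (by rw [mul_comm]; gcongr)

theorem bddAbove_lens (x : E) : BddAbove (Set.range
    fun u : {u : E // ‖u‖ ≤ 1 ∧ ‖u - ν‖ ≤ r} => (inner ℝ x ((u : E) - ν) : ℝ)) := by
  refine ⟨r * ‖x‖, ?_⟩
  rintro _ ⟨u, rfl⟩
  exact inner_sub_le_of_norm_sub_le u.2.2 x

theorem lensSupport_nonneg (hν : ‖ν‖ = 1) (hr : 0 ≤ r) (x : E) : 0 ≤ lensSupport ν r x := by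
  have := le_ciSup (bddAbove_lens (ν := ν) (r := r) x) ⟨ν, hν.le, by simpa using hr⟩
  simpa [lensSupport] using this

/-- The slow growth, at rate `r`, is what keeps sums over many vertices bounded. -/
theorem lensSupport_le (hν : ‖ν‖ = 1) (hr : 0 ≤ r) (x : E) : lensSupport ν r x ≤ r * ‖x‖ := by
  have : Nonempty {u : E // ‖u‖ ≤ 1 ∧ ‖u - ν‖ ≤ r} := ⟨⟨ν, hν.le, by simpa using hr⟩⟩
  exact ciSup_le fun u => inner_sub_le_of_norm_sub_le u.2.2 x

theorem convexOn_lensSupport (hν : ‖ν‖ = 1) (hr : 0 ≤ r) :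
    ConvexOn ℝ Set.univ (lensSupport ν r) := by
  have : Nonempty {u : E // ‖u‖ ≤ 1 ∧ ‖u - ν‖ ≤ r} := ⟨⟨ν, hν.le, by simpa using hr⟩⟩
  refine ⟨convex_univ, fun x _ y _ a b ha hb _ => ciSup_le fun u => ?_⟩
  rw [inner_add_left, real_inner_smul_left, real_inner_smul_left]
  exact add_le_add (mul_le_mul_of_nonneg_left (le_ciSup (bddAbove_lens x) u) ha)
    (mul_le_mul_of_nonneg_left (le_ciSup (bddAbove_lens y) u) hb)

/-- The supremum of `⟪x, u⟫` over the unit ball is attained at `x / ‖x‖`; if this direction lies in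
the lens, the second ball is no restriction. -/
theorem lensSupport_eq {x : E} (hx : x ≠ 0) (h : ‖‖x‖⁻¹ • x - ν‖ ≤ r) :
    lensSupport ν r x = ‖x‖ - inner ℝ x ν := by
  have hx' : ‖x‖ ≠ 0 := norm_ne_zero_iff.2 hx
  have h1 : ‖‖x‖⁻¹ • x‖ ≤ 1 := by
    rw [norm_smul, norm_inv, norm_norm, inv_mul_cancel₀ hx']
  have : Nonempty {u : E // ‖u‖ ≤ 1 ∧ ‖u - ν‖ ≤ r} := ⟨⟨_, h1, h⟩⟩
  apply le_antisymm
  · refine ciSup_le fun u => ?_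
    rw [inner_sub_right]
    have : inner ℝ x (u : E) ≤ ‖x‖ * 1 :=
      (real_inner_le_norm _ _).trans (by gcongr; exact u.2.1)
    linarith
  · refine le_trans (le_of_eq ?_) (le_ciSup (bddAbove_lens x) ⟨_, h1, h⟩)
    simp only [inner_sub_right, real_inner_smul_right, real_inner_self_eq_norm_sq]
    field_simp

/-- Around a nonzero vector whose direction lies in the open lens, the lens function differs from
the norm by a linear function. -/
theorem locallyMidconvexAt_lensSupport_sub_norm {w : E} (hw : w ≠ 0)
    (h : ‖‖w‖⁻¹ • w - ν‖ < r) :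
    LocallyMidconvexAt (fun x => lensSupport ν r x - ‖x‖) w := by
  have hcont : ContinuousAt (fun x : E => ‖‖x‖⁻¹ • x - ν‖) w := by
    have : ‖w‖ ≠ 0 := norm_ne_zero_iff.2 hw
    fun_prop (disch := assumption)
  have hlin : LocallyMidconvexAt (fun x : E => -(inner ℝ x ν : ℝ)) w := by
    refine Eventually.of_forall fun v => ?_
    simp only [inner_add_left, inner_sub_left]
    linarith
  refine hlin.of_touching ?_ ?_
  · rw [lensSupport_eq hw h.le]; ring
  · filter_upwards [hcont.eventually_lt continuousAt_const h, isOpen_ne.mem_nhds hw] with y hy hy0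
    rw [lensSupport_eq hy0 hy.le]
    exact le_of_eq (by ring)

end Lens

/-! ### Plane geometry of corners and the corner control -/

section Polygon

/-- The upward unit normal to a line of slope `m`. -/
noncomputable def unitNormal (m : ℝ) : EuclideanSpace ℝ (Fin 2) :=
  !₂[-m / √(1 + m ^ 2), 1 / √(1 + m ^ 2)]

theorem norm_sq_plane (w : EuclideanSpace ℝ (Fin 2)) : ‖w‖ ^ 2 = w 0 ^ 2 + w 1 ^ 2 := by
  simp [EuclideanSpace.real_norm_sq_eq, Fin.sum_univ_two]

theorem inner_plane (w z : EuclideanSpace ℝ (Fin 2)) :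
    inner ℝ w z = w 0 * z 0 + w 1 * z 1 := by
  simp [PiLp.inner_apply, Fin.sum_univ_two, mul_comm]

theorem norm_unitNormal (m : ℝ) : ‖unitNormal m‖ = 1 := by
  have h : 0 < 1 + m ^ 2 := by positivity
  have : ‖unitNormal m‖ ^ 2 = 1 ^ 2 := by
    rw [norm_sq_plane]
    simp only [unitNormal, PiLp.toLp_apply, Matrix.cons_val_zero, Matrix.cons_val_one, div_pow,
      Real.sq_sqrt h.le]
    field_simp
    ring
  exact (sq_eq_sq₀ (norm_nonneg _) zero_le_one).1 this

theorem inner_unitNormal (m : ℝ) (w : EuclideanSpace ℝ (Fin 2)) :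
    inner ℝ w (unitNormal m) = (w 1 - m * w 0) / √(1 + m ^ 2) := by
  rw [inner_plane]
  simp only [unitNormal, PiLp.toLp_apply, Matrix.cons_val_zero, Matrix.cons_val_one]
  ring

/-- A vector that is normal to a corner with slopes `m` and `m'` points in a direction close to one
of the two unit normals of the first side. -/
theorem norm_direction_sub_unitNormal_le {m m' : ℝ} {w : EuclideanSpace ℝ (Fin 2)} (hw : w ≠ 0)
    (h1 : 0 ≤ w 0 + m * w 1) (h2 : w 0 + m' * w 1 ≤ 0) :
    ‖‖w‖⁻¹ • w - unitNormal m‖ ≤ 2 * |m' - m| ∨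
      ‖‖w‖⁻¹ • w - -unitNormal m‖ ≤ 2 * |m' - m| := by
  set u := ‖w‖⁻¹ • w with hu
  have hw0 : 0 < ‖w‖ := norm_pos_iff.2 hw
  have hu1 : ‖u‖ = 1 := by rw [hu, norm_smul, norm_inv, norm_norm, inv_mul_cancel₀ hw0.ne']
  have hu2 : u 0 ^ 2 + u 1 ^ 2 = 1 := by rw [← norm_sq_plane, hu1, one_pow]
  have k1 : 0 ≤ u 0 + m * u 1 := by
    have : u 0 + m * u 1 = ‖w‖⁻¹ * (w 0 + m * w 1) := by simp [hu]; ring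
    rw [this]; positivity
  have k2 : u 0 + m' * u 1 ≤ 0 := by
    have : u 0 + m' * u 1 = ‖w‖⁻¹ * (w 0 + m' * w 1) := by simp [hu]; ring
    rw [this]; exact mul_nonpos_of_nonneg_of_nonpos (by positivity) h2
  set b : ℝ := inner ℝ u (unitNormal m) with hb
  -- `1 - b ^ 2` is the squared tangential component of `u`. The two sign conditions give `0 ≤ u 0 +
  -- m * u 1 ≤ -(m' - m) * u 1`.
  have hb2 : 1 - b ^ 2 ≤ (m' - m) ^ 2 := by
    have hp : 0 < 1 + m ^ 2 := by positivity
    have e1 : 1 - b ^ 2 = (u 0 + m * u 1) ^ 2 / (1 + m ^ 2) := by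
      rw [hb, inner_unitNormal, div_pow, Real.sq_sqrt hp.le, eq_div_iff hp.ne', sub_mul,
        div_mul_cancel₀ _ hp.ne', one_mul]
      linear_combination -(1 + m ^ 2) * hu2
    have e2 : (u 0 + m * u 1) ^ 2 ≤ ((m' - m) * u 1) ^ 2 := by
      rw [← neg_sq ((m' - m) * u 1)]
      exact pow_le_pow_left₀ k1 (by linarith) 2
    rw [e1]
    calc (u 0 + m * u 1) ^ 2 / (1 + m ^ 2) ≤ (u 0 + m * u 1) ^ 2 :=
          div_le_self (sq_nonneg _) (by nlinarith [sq_nonneg m])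
      _ ≤ (m' - m) ^ 2 * u 1 ^ 2 := by rw [← mul_pow]; exact e2
      _ ≤ (m' - m) ^ 2 * 1 := by gcongr; nlinarith [sq_nonneg (u 0)]
      _ = _ := mul_one _
  have hb1 : b ^ 2 ≤ 1 := by
    have := abs_real_inner_le_norm u (unitNormal m)
    rw [hu1, norm_unitNormal, one_mul] at this
    exact (sq_le_one_iff_abs_le_one _).2 this
  have hfin : ∀ z : EuclideanSpace ℝ (Fin 2), ‖z‖ ^ 2 ≤ 2 * (m' - m) ^ 2 →
      ‖z‖ ≤ 2 * |m' - m| := fun z hz => by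
    refine abs_le_of_sq_le_sq' ?_ (by positivity) |>.2
    rw [mul_pow, sq_abs]
    nlinarith [sq_nonneg (m' - m)]
  -- For the normal on the side of `u` the squared distance is `2 - 2|b|`, at most `2 (1 - b ^ 2)`
  -- because `|b| ≤ 1`.
  rcases le_total 0 b with h | h
  · refine Or.inl (hfin _ ?_)
    rw [norm_sub_sq_real, hu1, norm_unitNormal, ← hb]
    nlinarith
  · refine Or.inr (hfin _ ?_)
    rw [norm_sub_sq_real, hu1, norm_neg, norm_unitNormal, inner_neg_right, ← hb]
    nlinarith

/-- First-order optimality: the direction towards a point no closer along a segment. -/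
theorem inner_nonpos_of_forall_norm_le {E : Type*} [NormedAddCommGroup E] [InnerProductSpace ℝ E]
    {w z : E} (h : ∀ s ∈ Set.Icc (0 : ℝ) 1, ‖w‖ ≤ ‖w - s • z‖) : inner ℝ w z ≤ 0 := by
  by_contra! hpos
  have hz : 0 < ‖z‖ ^ 2 := by
    have : z ≠ 0 := by rintro rfl; simp at hpos
    positivity
  set c : ℝ := inner ℝ w z with hc
  -- With `s‖z‖² ≤ c`, moving by `s • z` lowers the squared norm by at least `s * c > 0`.
  set s := min 1 (c / ‖z‖ ^ 2) with hs
  have hs0 : 0 < s := lt_min one_pos (by positivity)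
  have h1 := pow_le_pow_left₀ (norm_nonneg w) (h s ⟨hs0.le, min_le_left _ _⟩) 2
  rw [norm_sub_sq_real, norm_smul, real_inner_smul_right, mul_pow, Real.norm_eq_abs, sq_abs,
    ← hc] at h1
  have h2 : s * ‖z‖ ^ 2 ≤ c := (le_div_iff₀ hz).1 (min_le_right _ _)
  nlinarith [mul_pos hs0 hpos]

/-- The point of the graph of `f` above `s`. -/
noncomputable def graphPoint (f : ℝ → ℝ) (s : ℝ) : EuclideanSpace ℝ (Fin 2) := !₂[s, f s]

/-- The polygonal line inscribed in the graph of `f`, with vertices above `t 0, …, t n`. -/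
def inscribedPolygon (f : ℝ → ℝ) (t : ℕ → ℝ) (n : ℕ) : Set (EuclideanSpace ℝ (Fin 2)) :=
  ⋃ j ∈ Finset.range n, segment ℝ (graphPoint f (t j)) (graphPoint f (t (j + 1)))

/-- A sum of lens functions controlling the distance function of an inscribed polygon near its
interior vertices. -/
noncomputable def cornerControl (f : ℝ → ℝ) (t r : ℕ → ℝ) (n : ℕ)
    (x : EuclideanSpace ℝ (Fin 2)) : ℝ :=
  ∑ j ∈ Finset.range (n - 1),
    (lensSupport (unitNormal (slope f (t j) (t (j + 1)))) (r j) (x - graphPoint f (t (j + 1))) +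
      lensSupport (-unitNormal (slope f (t j) (t (j + 1)))) (r j)
        (x - graphPoint f (t (j + 1))))

variable {f : ℝ → ℝ} {t r : ℕ → ℝ} {n : ℕ}

theorem isCompact_inscribedPolygon : IsCompact (inscribedPolygon f t n) := by
  refine (Finset.range n).isCompact_biUnion fun j _ => ?_
  rw [segment_eq_image_lineMap]
  exact isCompact_Icc.image (by fun_prop)

theorem graphPoint_mem_inscribedPolygon {j : ℕ} (hn : 0 < n) (hj : j ≤ n) :
    graphPoint f (t j) ∈ inscribedPolygon f t n := by
  rw [inscribedPolygon, Set.mem_iUnion₂]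
  rcases hj.lt_or_eq with h | rfl
  · exact ⟨j, Finset.mem_range.2 h, left_mem_segment ..⟩
  · refine ⟨j - 1, Finset.mem_range.2 (by omega), ?_⟩
    rw [Nat.sub_add_cancel hn]
    exact right_mem_segment ..

theorem convexOn_comp_sub_const {E : Type*} [AddCommGroup E] [Module ℝ E] {φ : E → ℝ}
    (hφ : ConvexOn ℝ Set.univ φ) (p : E) : ConvexOn ℝ Set.univ fun x => φ (x - p) := by
  simpa [Function.comp_def, sub_eq_add_neg] using hφ.translate_left (-p)

theorem convexOn_sum_univ {E ι : Type*} [AddCommGroup E] [Module ℝ E] {s : Finset ι}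
    {φ : ι → E → ℝ} (hφ : ∀ i ∈ s, ConvexOn ℝ Set.univ (φ i)) :
    ConvexOn ℝ Set.univ fun x => ∑ i ∈ s, φ i x := by
  classical
  induction s using Finset.induction_on with
  | empty => simpa using convexOn_const (0 : ℝ) convex_univ
  | insert i s hi ih =>
    simp only [Finset.sum_insert hi]
    exact (hφ i (by simp)).add (ih fun j hj => hφ j (by simp [hj]))

theorem convexOn_cornerControl_term (hr : ∀ j, 0 ≤ r j) (j : ℕ) :
    ConvexOn ℝ Set.univ fun x =>
    (lensSupport (unitNormal (slope f (t j) (t (j + 1)))) (r j) (x - graphPoint f (t (j + 1))) +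
      lensSupport (-unitNormal (slope f (t j) (t (j + 1)))) (r j)
        (x - graphPoint f (t (j + 1)))) :=
  (convexOn_comp_sub_const (convexOn_lensSupport (norm_unitNormal _) (hr j)) _).add
    (convexOn_comp_sub_const
      (convexOn_lensSupport (by rw [norm_neg, norm_unitNormal]) (hr j)) _)

theorem convexOn_cornerControl (hr : ∀ j, 0 ≤ r j) :
    ConvexOn ℝ Set.univ (cornerControl f t r n) :=
  convexOn_sum_univ fun j _ => convexOn_cornerControl_term hr j

theorem cornerControl_nonneg (hr : ∀ j, 0 ≤ r j) (x : EuclideanSpace ℝ (Fin 2)) :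
    0 ≤ cornerControl f t r n x :=
  Finset.sum_nonneg fun j _ => add_nonneg (lensSupport_nonneg (norm_unitNormal _) (hr j) _)
    (lensSupport_nonneg (by rw [norm_neg, norm_unitNormal]) (hr j) _)

theorem cornerControl_le (hr : ∀ j, 0 ≤ r j) {R : ℝ} (hn : 0 < n)
    (hR : ∀ j ≤ n, ‖graphPoint f (t j)‖ ≤ R) (x : EuclideanSpace ℝ (Fin 2)) :
    cornerControl f t r n x ≤ 2 * (∑ j ∈ Finset.range (n - 1), r j) * (‖x‖ + R) := by
  rw [Finset.mul_sum, Finset.sum_mul]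
  refine Finset.sum_le_sum fun j hj => ?_
  have hj' : j + 1 ≤ n := by have := Finset.mem_range.1 hj; omega
  have h0 : ‖x - graphPoint f (t (j + 1))‖ ≤ ‖x‖ + R :=
    (norm_sub_le _ _).trans (by gcongr; exact hR _ hj')
  have h1 := lensSupport_le (norm_unitNormal (slope f (t j) (t (j + 1)))) (hr j)
    (x - graphPoint f (t (j + 1)))
  have h2 := lensSupport_le (ν := -unitNormal (slope f (t j) (t (j + 1))))
    (by rw [norm_neg, norm_unitNormal]) (hr j) (x - graphPoint f (t (j + 1)))
  have h3 := mul_le_mul_of_nonneg_left h0 (hr j)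
  linarith

end Polygon

/-! ### Midconvexity off an inscribed polygon -/

section Polygon

variable {f : ℝ → ℝ} {t r : ℕ → ℝ} {n : ℕ}

theorem inner_graphPoint_sub {a b : ℝ} (hab : a ≠ b) (w : EuclideanSpace ℝ (Fin 2)) :
    inner ℝ w (graphPoint f b - graphPoint f a) = (b - a) * (w 0 + slope f a b * w 1) := by
  have h : b - a ≠ 0 := sub_ne_zero.2 hab.symm
  rw [inner_plane, slope_def_field]
  simp only [graphPoint, PiLp.sub_apply, Matrix.cons_val_zero,
    Matrix.cons_val_one]
  field_simp

theorem norm_sub_le_of_infDist_eq {E : Type*} [NormedAddCommGroup E] {S : Set E} {x p q : E}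
    (hp : Metric.infDist x S = ‖x - p‖) (hq : q ∈ S) : ‖x - p‖ ≤ ‖x - q‖ := by
  rw [← hp, ← dist_eq_norm]
  exact Metric.infDist_le_dist_of_mem hq

theorem inner_nonpos_of_infDist_eq {E : Type*} [NormedAddCommGroup E] [InnerProductSpace ℝ E]
    {S : Set E} {x p q : E} (hp : Metric.infDist x S = ‖x - p‖) (hq : segment ℝ p q ⊆ S) :
    inner ℝ (x - p) (q - p) ≤ 0 := by
  refine inner_nonpos_of_forall_norm_le fun s hs => ?_
  have hmem : p + s • (q - p) ∈ segment ℝ p q := by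
    rw [segment_eq_image']
    exact ⟨s, hs, rfl⟩
  have := norm_sub_le_of_infDist_eq hp (hq hmem)
  rwa [← sub_sub] at this

/-- Optimality along the two adjacent sides places `x - p` in the normal cone of the corner, so its
direction lies in one of the two open lenses at `p`. That lens function equals `‖y - p‖` up to a
linear term near `x`; all other terms are convex, and `‖y - p‖` touches the distance from above. -/
theorem locallyMidconvexAt_of_vertex_nearest (ht : StrictMono t)
    (hr : ∀ j, 2 * |slope f (t (j + 1)) (t (j + 2)) - slope f (t j) (t (j + 1))| < r j)
    {j : ℕ} (hj : j + 1 < n) {x : EuclideanSpace ℝ (Fin 2)}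
    (hx : x ≠ graphPoint f (t (j + 1)))
    (hd : Metric.infDist x (inscribedPolygon f t n) = ‖x - graphPoint f (t (j + 1))‖) :
    LocallyMidconvexAt
      (fun y => cornerControl f t r n y - Metric.infDist y (inscribedPolygon f t n)) x := by
  have hr0 : ∀ j, 0 ≤ r j := fun j => (by positivity : (0 : ℝ) ≤ _).trans (hr j).le
  set p := graphPoint f (t (j + 1)) with hpdef
  have hw : x - p ≠ 0 := sub_ne_zero.2 hx
  have hseg : ∀ i < n, segment ℝ (graphPoint f (t i)) (graphPoint f (t (i + 1))) ⊆
      inscribedPolygon f t n := fun i hi =>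
    Set.subset_biUnion_of_mem (u := fun i =>
      segment ℝ (graphPoint f (t i)) (graphPoint f (t (i + 1)))) (Finset.mem_range.2 hi)
  have i1 : inner ℝ (x - p) (graphPoint f (t j) - p) ≤ 0 :=
    inner_nonpos_of_infDist_eq hd (by rw [segment_symm]; exact hseg j (by omega))
  have i2 : inner ℝ (x - p) (graphPoint f (t (j + 2)) - p) ≤ 0 :=
    inner_nonpos_of_infDist_eq hd (hseg (j + 1) hj)
  have t1 : t j < t (j + 1) := ht (by omega)
  have t2 : t (j + 1) < t (j + 2) := ht (by omega)
  rw [← neg_sub p (graphPoint f (t j)), inner_neg_right, hpdef, inner_graphPoint_sub t1.ne, ← hpdef] at i1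
  rw [hpdef, inner_graphPoint_sub t2.ne, ← hpdef] at i2
  have k1 : 0 ≤ (x - p) 0 + slope f (t j) (t (j + 1)) * (x - p) 1 := by
    by_contra! h
    nlinarith [mul_pos (sub_pos.2 t1) (neg_pos.2 h)]
  have k2 : (x - p) 0 + slope f (t (j + 1)) (t (j + 2)) * (x - p) 1 ≤ 0 := by
    by_contra! h
    nlinarith [mul_pos (sub_pos.2 t2) h]
  have hmem : j ∈ Finset.range (n - 1) := Finset.mem_range.2 (by omega)
  have hle : ∀ y, Metric.infDist y (inscribedPolygon f t n) ≤ ‖y - p‖ := fun y => by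
    rw [← dist_eq_norm]
    exact Metric.infDist_le_dist_of_mem (graphPoint_mem_inscribedPolygon (by omega) (by omega))
  have shift : ∀ {φ : EuclideanSpace ℝ (Fin 2) → ℝ}, LocallyMidconvexAt φ (x - p) →
      LocallyMidconvexAt (fun y => φ (y - p)) x := fun {φ} h => by
    filter_upwards [h] with v hv
    rwa [add_sub_right_comm, sub_right_comm]
  have hrest : LocallyMidconvexAt (fun y => ∑ i ∈ (Finset.range (n - 1)).erase j,
      (lensSupport (unitNormal (slope f (t i) (t (i + 1)))) (r i)
          (y - graphPoint f (t (i + 1))) +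
        lensSupport (-unitNormal (slope f (t i) (t (i + 1)))) (r i)
          (y - graphPoint f (t (i + 1))))) x :=
    .of_convexOn_univ (convexOn_sum_univ fun i _ => convexOn_cornerControl_term hr0 i)
  have hmain : LocallyMidconvexAt (fun y =>
      (lensSupport (unitNormal (slope f (t j) (t (j + 1)))) (r j) (y - p) +
        lensSupport (-unitNormal (slope f (t j) (t (j + 1)))) (r j) (y - p)) - ‖y - p‖) x := by
    rcases norm_direction_sub_unitNormal_le hw k1 k2 with h | h
    · have a1 := shift (locallyMidconvexAt_lensSupport_sub_norm hw (h.trans_lt (hr j)))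
      have a2 : LocallyMidconvexAt _ x := .of_convexOn_univ (convexOn_comp_sub_const
        (convexOn_lensSupport (ν := -unitNormal (slope f (t j) (t (j + 1))))
          (by rw [norm_neg, norm_unitNormal]) (hr0 j)) p)
      exact (a1.add a2).congr fun y => by ring
    · have a1 := shift (locallyMidconvexAt_lensSupport_sub_norm hw (h.trans_lt (hr j)))
      have a2 : LocallyMidconvexAt _ x := .of_convexOn_univ (convexOn_comp_sub_const
        (convexOn_lensSupport (norm_unitNormal (slope f (t j) (t (j + 1)))) (hr0 j)) p)
      exact (a1.add a2).congr fun y => by ring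
  have hsplit : ∀ y, cornerControl f t r n y - ‖y - p‖ =
      ((lensSupport (unitNormal (slope f (t j) (t (j + 1)))) (r j) (y - p) +
        lensSupport (-unitNormal (slope f (t j) (t (j + 1)))) (r j) (y - p)) - ‖y - p‖) +
      ∑ i ∈ (Finset.range (n - 1)).erase j,
      (lensSupport (unitNormal (slope f (t i) (t (i + 1)))) (r i)
          (y - graphPoint f (t (i + 1))) +
        lensSupport (-unitNormal (slope f (t i) (t (i + 1)))) (r i)
          (y - graphPoint f (t (i + 1)))) := fun y => by
    rw [cornerControl, ← Finset.add_sum_erase _ _ hmem]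
    ring
  refine (hmain.add hrest).of_touching ?_ (Eventually.of_forall fun y => ?_)
  · rw [hd, ← hsplit]
  · rw [← hsplit]
    linarith [hle y]

/-- Near `x` the distance is at most the distance to the line through the segment, with equality at
`x`; off the line the latter is locally linear, so no control is needed. -/
theorem locallyMidconvexAt_of_segment_nearest {a b : ℝ} (hab : a < b)
    {S : Set (EuclideanSpace ℝ (Fin 2))}
    (hS : segment ℝ (graphPoint f a) (graphPoint f b) ⊆ S)
    {x p : EuclideanSpace ℝ (Fin 2)} {s : ℝ} (hs : s ∈ Set.Ioo (0 : ℝ) 1)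
    (hps : p = graphPoint f a + s • (graphPoint f b - graphPoint f a)) (hx : x ≠ p)
    (hd : Metric.infDist x S = ‖x - p‖) :
    LocallyMidconvexAt (fun y => -Metric.infDist y S) x := by
  set m := slope f a b with hm
  have hq : 0 < 1 + m ^ 2 := by positivity
  have hba : 0 < b - a := sub_pos.2 hab
  have hpseg : p ∈ segment ℝ (graphPoint f a) (graphPoint f b) := by
    rw [segment_eq_image', hps]
    exact ⟨s, ⟨hs.1.le, hs.2.le⟩, rfl⟩
  have hv : graphPoint f b - graphPoint f a = (b - a) • !₂[1, m] := by
    ext i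
    fin_cases i
    · simp [graphPoint]
    · simp only [graphPoint, hm, slope_def_field]
      simp
      field_simp
  have i1 : inner ℝ (x - p) (graphPoint f a - p) ≤ 0 := inner_nonpos_of_infDist_eq hd
    (((convex_segment _ _).segment_subset hpseg (left_mem_segment ..)).trans hS)
  have i2 : inner ℝ (x - p) (graphPoint f b - p) ≤ 0 := inner_nonpos_of_infDist_eq hd
    (((convex_segment _ _).segment_subset hpseg (right_mem_segment ..)).trans hS)
  have e1 : graphPoint f a - p = -(s • (graphPoint f b - graphPoint f a)) := by
    rw [hps]; module
  have e2 : graphPoint f b - p = (1 - s) • (graphPoint f b - graphPoint f a) := by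
    rw [hps]; module
  rw [e1, inner_neg_right, real_inner_smul_right, inner_graphPoint_sub hab.ne] at i1
  rw [e2, real_inner_smul_right, inner_graphPoint_sub hab.ne] at i2
  have horth : (x - p) 0 + m * (x - p) 1 = 0 := by
    have c1 : 0 < s * (b - a) := mul_pos hs.1 hba
    have c2 : 0 < (1 - s) * (b - a) := mul_pos (by linarith [hs.2]) hba
    apply le_antisymm
    · by_contra! h
      nlinarith [mul_pos c2 h]
    · by_contra! h
      nlinarith [mul_pos c1 (neg_pos.2 h)]
  -- `σ y` is the parameter of the projection of `y` to the line through the segment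
  set σ : EuclideanSpace ℝ (Fin 2) → ℝ := fun y =>
    s + ((y - p) 0 + m * (y - p) 1) / ((b - a) * (1 + m ^ 2)) with hσ
  have hσx : σ x = s := by simp only [hσ, horth]; simp
  have hσc : Continuous σ := by
    simp only [hσ, PiLp.sub_apply]
    fun_prop
  have hσev : ∀ᶠ y in 𝓝 x, σ y ∈ Set.Ioo (0 : ℝ) 1 :=
    hσc.continuousAt.eventually (by rw [hσx]; exact isOpen_Ioo.mem_nhds hs)
  have hproj : ∀ y, y - (graphPoint f a + σ y • (graphPoint f b - graphPoint f a)) =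
      (inner ℝ (y - p) (unitNormal m) : ℝ) • unitNormal m := fun y => by
    have e3 : y - (graphPoint f a + σ y • (graphPoint f b - graphPoint f a)) =
        (y - p) - (((y - p) 0 + m * (y - p) 1) / (1 + m ^ 2)) • !₂[1, m] := by
      have e4 : ((y - p) 0 + m * (y - p) 1) / (1 + m ^ 2) = (σ y - s) * (b - a) := by
        simp only [hσ]
        field_simp
        ring
      rw [e4, mul_smul, ← hv]
      have e5 : y - p = y - (graphPoint f a + s • (graphPoint f b - graphPoint f a)) := by
        rw [← hps]
      rw [e5]
      module
    rw [e3, inner_unitNormal]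
    generalize y - p = w
    have hsq : √(1 + m ^ 2) ^ 2 = 1 + m ^ 2 := Real.sq_sqrt hq.le
    have hne : √(1 + m ^ 2) ≠ 0 := (Real.sqrt_pos.2 hq).ne'
    ext i
    fin_cases i
    · simp [unitNormal]
      field_simp
      rw [hsq]
      ring
    · simp [unitNormal]
      field_simp
      rw [hsq]
      ring
  have hdist : ∀ᶠ y in 𝓝 x, Metric.infDist y S ≤ |inner ℝ (y - p) (unitNormal m)| := by
    filter_upwards [hσev] with y hy
    have hmem : graphPoint f a + σ y • (graphPoint f b - graphPoint f a) ∈ S :=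
      hS (by rw [segment_eq_image']; exact ⟨σ y, ⟨hy.1.le, hy.2.le⟩, rfl⟩)
    have := Metric.infDist_le_dist_of_mem (x := y) hmem
    rwa [dist_eq_norm, hproj, norm_smul, norm_unitNormal, mul_one, Real.norm_eq_abs] at this
  have hxd : Metric.infDist x S = |inner ℝ (x - p) (unitNormal m)| := by
    have := hproj x
    rw [hσx, ← hps] at this
    rw [hd]
    nth_rewrite 1 [this]
    rw [norm_smul, norm_unitNormal, mul_one, Real.norm_eq_abs]
  have hne : (inner ℝ (x - p) (unitNormal m) : ℝ) ≠ 0 := by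
    intro h
    rw [h, abs_zero, hd] at hxd
    exact hx (sub_eq_zero.1 (norm_eq_zero.1 hxd))
  have hcont : ContinuousAt (fun y => (inner ℝ (y - p) (unitNormal m) : ℝ)) x := by fun_prop
  rcases hne.lt_or_gt with h | h
  · have hlin : LocallyMidconvexAt (fun y => (inner ℝ (y - p) (unitNormal m) : ℝ)) x :=
      Eventually.of_forall fun v => by
        simp only [inner_add_left, inner_sub_left]; linarith
    refine hlin.of_touching ?_ ?_
    · simp only [hxd, abs_of_neg h, neg_neg]
    · filter_upwards [hdist, hcont.eventually_lt continuousAt_const h] with y h1 h2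
      rw [abs_of_neg h2] at h1
      linarith
  · have hlin : LocallyMidconvexAt (fun y => -(inner ℝ (y - p) (unitNormal m) : ℝ)) x :=
      Eventually.of_forall fun v => by
        simp only [inner_add_left, inner_sub_left]; linarith
    refine hlin.of_touching ?_ ?_
    · simp only [hxd, abs_of_pos h]
    · filter_upwards [hdist, continuousAt_const.eventually_lt hcont h] with y h1 h2
      rw [abs_of_pos h2] at h1
      linarith

theorem convexOn_norm_sub {E : Type*} [NormedAddCommGroup E] [NormedSpace ℝ E] (p : E) :
    ConvexOn ℝ Set.univ fun y : E => ‖y - p‖ :=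
  convexOn_comp_sub_const convexOn_univ_norm p

/-- Off an inscribed polygon, the corner control and the distances to the endpoints compensate the
convex part of the distance function of the polygon. -/
theorem locallyMidconvexAt_off_inscribedPolygon (ht : StrictMono t) (hn : 0 < n)
    (hr : ∀ j, 2 * |slope f (t (j + 1)) (t (j + 2)) - slope f (t j) (t (j + 1))| < r j)
    {x : EuclideanSpace ℝ (Fin 2)} (hx : x ∉ inscribedPolygon f t n) :
    LocallyMidconvexAt (fun y => cornerControl f t r n y + ‖y - graphPoint f (t 0)‖ +
      ‖y - graphPoint f (t n)‖ - Metric.infDist y (inscribedPolygon f t n)) x := by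
  have hr0 : ∀ j, 0 ≤ r j := fun j => (by positivity : (0 : ℝ) ≤ _).trans (hr j).le
  have hC : LocallyMidconvexAt (cornerControl f t r n) x :=
    .of_convexOn_univ (convexOn_cornerControl hr0)
  have h0 : LocallyMidconvexAt (fun y => ‖y - graphPoint f (t 0)‖) x :=
    .of_convexOn_univ (convexOn_norm_sub _)
  have h1 : LocallyMidconvexAt (fun y => ‖y - graphPoint f (t n)‖) x :=
    .of_convexOn_univ (convexOn_norm_sub _)
  have hle : ∀ j ≤ n, ∀ y, Metric.infDist y (inscribedPolygon f t n) ≤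
      ‖y - graphPoint f (t j)‖ := fun j hj y => by
    rw [← dist_eq_norm]
    exact Metric.infDist_le_dist_of_mem (graphPoint_mem_inscribedPolygon hn hj)
  obtain ⟨p, hp, hpd⟩ := isCompact_inscribedPolygon.exists_infDist_eq_dist
    ⟨_, graphPoint_mem_inscribedPolygon (f := f) (t := t) hn (Nat.zero_le n)⟩ x
  rw [dist_eq_norm] at hpd
  have hxp : x ≠ p := by rintro rfl; exact hx hp
  have vertex : ∀ i ≤ n, p = graphPoint f (t i) →
      LocallyMidconvexAt (fun y => cornerControl f t r n y + ‖y - graphPoint f (t 0)‖ +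
      ‖y - graphPoint f (t n)‖ - Metric.infDist y (inscribedPolygon f t n)) x := by
    rintro i hi rfl
    -- An end vertex has no corner term; the norm centred at it cancels the upper bound for the
    -- distance.
    rcases Nat.eq_zero_or_pos i with rfl | hi0
    · refine (hC.add h1).of_touching (by rw [hpd]; ring) (Eventually.of_forall fun y => ?_)
      linarith [hle 0 hi y]
    rcases hi.lt_or_eq with hin | rfl
    · obtain ⟨j, rfl⟩ : ∃ j, i = j + 1 := ⟨i - 1, by omega⟩
      have := locallyMidconvexAt_of_vertex_nearest ht hr hin hxp hpd
      exact ((this.add h0).add h1).congr fun y => by ring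
    · refine (hC.add h0).of_touching (by rw [hpd]; ring) (Eventually.of_forall fun y => ?_)
      linarith [hle i hi y]
  have hp' := hp
  rw [inscribedPolygon, Set.mem_iUnion₂] at hp'
  obtain ⟨j, hj, hpj⟩ := hp'
  have hjn := Finset.mem_range.1 hj
  rw [segment_eq_image'] at hpj
  obtain ⟨s, hs, hps⟩ := hpj
  rcases hs.1.eq_or_lt with h | hs0
  · exact vertex j hjn.le (by rw [← hps, ← h]; simp)
  rcases hs.2.eq_or_lt with h | hs1
  · exact vertex (j + 1) hjn (by rw [← hps, h]; simp)
  have := locallyMidconvexAt_of_segment_nearest (ht (Nat.lt_succ_self j))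
    (Set.subset_biUnion_of_mem (u := fun i =>
      segment ℝ (graphPoint f (t i)) (graphPoint f (t (i + 1)))) hj) ⟨hs0, hs1⟩ hps.symm hxp hpd
  exact (((hC.add h0).add h1).add this).congr fun y => (sub_eq_add_neg _ _).symm

end Polygon

/-! ### Pointwise limits -/

theorem convexOn_of_tendsto {E ι : Type*} [AddCommGroup E] [Module ℝ E] {s : Set E}
    (hs : Convex ℝ s) {l : Filter ι} [l.NeBot] {φ : ι → E → ℝ} {ψ : E → ℝ}
    (hφ : ∀ᶠ i in l, ConvexOn ℝ s (φ i)) (h : ∀ x ∈ s, Tendsto (fun i => φ i x) l (𝓝 (ψ x))) :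
    ConvexOn ℝ s ψ := by
  refine ⟨hs, fun x hx y hy a b ha hb hab => ?_⟩
  refine le_of_tendsto_of_tendsto (h _ (hs hx hy ha hb hab))
    (((h x hx).const_smul a).add ((h y hy).const_smul b)) ?_
  filter_upwards [hφ] with i hi
  exact hi.2 hx hy ha hb hab

/-- A pointwise bounded sequence of functions converges pointwise along some filter finer than
`atTop`. -/
theorem exists_filter_tendsto_pointwise {E : Type*} {H : ℕ → E → ℝ} {B : E → ℝ}
    (hH : ∀ n x, H n x ∈ Set.Icc 0 (B x)) :
    ∃ (l : Filter ℕ) (K : E → ℝ), l.NeBot ∧ l ≤ atTop ∧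
      ∀ x, Tendsto (fun n => H n x) l (𝓝 (K x)) := by
  -- A nonprincipal ultrafilter gives limits at all points simultaneously, without extracting
  -- subsequences.
  have key : ∀ x, ∃ y, Tendsto (fun n => H n x) (hyperfilter ℕ : Filter ℕ) (𝓝 y) := fun x => by
    obtain ⟨y, -, hy⟩ := (isCompact_Icc (a := (0 : ℝ)) (b := B x)).ultrafilter_le_nhds
      ((hyperfilter ℕ).map fun n => H n x)
      (le_principal_iff.2 (Filter.mem_map.2 (Eventually.of_forall fun n => hH n x)))
    exact ⟨y, hy⟩
  choose K hK using key
  exact ⟨hyperfilter ℕ, K, inferInstance, Nat.hyperfilter_le_atTop, hK⟩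

theorem infDist_le_infDist_add {X : Type*} [PseudoMetricSpace X] {P Q : Set X} {ε : ℝ}
    (hQ : Q.Nonempty) (h : ∀ q ∈ Q, ∃ p ∈ P, dist q p ≤ ε) (x : X) :
    Metric.infDist x P ≤ Metric.infDist x Q + ε := by
  rw [← sub_le_iff_le_add, Metric.le_infDist hQ]
  intro q hq
  obtain ⟨p, hp, hqp⟩ := h q hq
  linarith [Metric.infDist_le_dist_of_mem (x := x) hp, dist_triangle x q p]

/-! ### Total variation of chord slopes -/

section Slopes

variable {g k f : ℝ → ℝ} {t : ℕ → ℝ} {n : ℕ}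

theorem slope_le_slope_of_convexOn (hg : ConvexOn ℝ Set.univ g) {x y z : ℝ} (hxy : x < y)
    (hyz : y < z) : slope g x y ≤ slope g y z := by
  rw [slope_def_field, slope_def_field]
  exact hg.slope_mono_adjacent (Set.mem_univ _) (Set.mem_univ _) hxy hyz

/-- The sum telescopes, and unit chords outside the partition bound the extreme slopes by quantities
depending only on the end nodes. -/
theorem sum_slope_diff_le (hg : ConvexOn ℝ Set.univ g) (ht : StrictMono t) :
    ∑ j ∈ Finset.range n, (slope g (t (j + 1)) (t (j + 2)) - slope g (t j) (t (j + 1))) ≤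
      slope g (t (n + 1)) (t (n + 1) + 1) - slope g (t 0 - 1) (t 0) := by
  rw [Finset.sum_range_sub (fun j => slope g (t j) (t (j + 1)))]
  have h1 := slope_le_slope_of_convexOn hg (ht (Nat.lt_succ_self n)) (lt_add_one (t (n + 1)))
  have h2 := slope_le_slope_of_convexOn hg (sub_one_lt (t 0)) (ht (Nat.lt_succ_self 0))
  linarith

/-- Slope increments of `g` and `k` are nonnegative, so the absolute value of their difference is at
most their sum. -/
theorem sum_abs_slope_diff_le (hg : ConvexOn ℝ Set.univ g) (hk : ConvexOn ℝ Set.univ k)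
    (hf : ∀ x, f x = g x - k x) (ht : StrictMono t) :
    ∑ j ∈ Finset.range n, |slope f (t (j + 1)) (t (j + 2)) - slope f (t j) (t (j + 1))| ≤
      (slope g (t (n + 1)) (t (n + 1) + 1) - slope g (t 0 - 1) (t 0)) +
      (slope k (t (n + 1)) (t (n + 1) + 1) - slope k (t 0 - 1) (t 0)) := by
  refine le_trans ?_ (add_le_add (sum_slope_diff_le hg ht) (sum_slope_diff_le hk ht))
  rw [← Finset.sum_add_distrib]
  refine Finset.sum_le_sum fun j _ => ?_
  have hs : ∀ x y, slope f x y = slope g x y - slope k x y := fun x y => by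
    rw [slope_def_field, slope_def_field, slope_def_field, hf, hf]; ring
  have h1 := slope_le_slope_of_convexOn hg (ht (by omega : j < j + 1))
    (ht (by omega : j + 1 < j + 2))
  have h2 := slope_le_slope_of_convexOn hk (ht (by omega : j < j + 1))
    (ht (by omega : j + 1 < j + 2))
  rw [hs, hs, abs_le]
  constructor <;> linarith

end Slopes

/-! ### Convergence of inscribed polygons -/

section Approximation

variable {f : ℝ → ℝ} {a b : ℝ}

theorem continuous_graphPoint (hf : Continuous f) : Continuous (graphPoint f) := by
  unfold graphPoint
  refine (PiLp.continuous_toLp 2 _).comp (continuous_pi fun i => ?_)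
  fin_cases i
  · exact continuous_id
  · exact hf

/-- The nodes of the equidistant partition of `[a, b]` into `n + 1` intervals. -/
noncomputable def uniformNode (a b : ℝ) (n j : ℕ) : ℝ := a + j * ((b - a) / (n + 1))

theorem uniformNode_zero (n : ℕ) : uniformNode a b n 0 = a := by simp [uniformNode]

theorem uniformNode_last (n : ℕ) : uniformNode a b n (n + 1) = b := by
  have : (n : ℝ) + 1 ≠ 0 := by positivity
  simp only [uniformNode]
  push_cast
  field_simp
  ring

theorem strictMono_uniformNode (hab : a < b) (n : ℕ) : StrictMono (uniformNode a b n) :=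
  strictMono_nat_of_lt_succ fun j => by
    have : 0 < (b - a) / ((n : ℝ) + 1) := div_pos (sub_pos.2 hab) (by positivity)
    simp only [uniformNode]
    push_cast
    linarith

theorem uniformNode_mem_Icc (hab : a < b) {n j : ℕ} (hj : j ≤ n + 1) :
    uniformNode a b n j ∈ Set.Icc a b := by
  have hm := (strictMono_uniformNode hab n).monotone
  have h1 := hm (Nat.zero_le j)
  have h2 := hm hj
  rw [uniformNode_zero] at h1
  rw [uniformNode_last] at h2
  exact ⟨h1, h2⟩

theorem eventually_inscribedPolygon_close (hf : Continuous f) (hab : a < b) {ε : ℝ}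
    (hε : 0 < ε) : ∀ᶠ n : ℕ in atTop,
      (∀ p ∈ inscribedPolygon f (uniformNode a b n) (n + 1),
        ∃ q ∈ graphPoint f '' Set.Icc a b, dist p q ≤ ε) ∧
      ∀ q ∈ graphPoint f '' Set.Icc a b,
        ∃ p ∈ inscribedPolygon f (uniformNode a b n) (n + 1), dist q p ≤ ε := by
  have huc := (isCompact_Icc (a := a) (b := b)).uniformContinuousOn_of_continuous
    (continuous_graphPoint hf).continuousOn
  obtain ⟨δ, hδ, hfδ⟩ := Metric.uniformContinuousOn_iff.1 huc ε hε
  obtain ⟨N, hN⟩ := exists_nat_gt ((b - a) / δ)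
  filter_upwards [eventually_ge_atTop N] with n hn
  have hba : 0 < b - a := sub_pos.2 hab
  have hn1 : (0 : ℝ) < n + 1 := by positivity
  set h := (b - a) / ((n : ℝ) + 1) with hh
  have hpos : 0 < h := div_pos hba hn1
  have hlt : h < δ := by
    rw [div_lt_iff₀ hδ] at hN
    rw [hh, div_lt_iff₀ hn1]
    have : (N : ℝ) ≤ n := by exact_mod_cast hn
    nlinarith
  constructor
  · intro p hp
    rw [inscribedPolygon, Set.mem_iUnion₂] at hp
    obtain ⟨j, hj, hpj⟩ := hp
    have hjn := Finset.mem_range.1 hj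
    have m1 := uniformNode_mem_Icc (n := n) hab hjn.le
    have m2 := uniformNode_mem_Icc (n := n) hab (j := j + 1) hjn
    refine ⟨_, ⟨_, m1, rfl⟩, ?_⟩
    have hsub : segment ℝ (graphPoint f (uniformNode a b n j))
        (graphPoint f (uniformNode a b n (j + 1))) ⊆
        Metric.closedBall (graphPoint f (uniformNode a b n j)) ε := by
      refine (convex_closedBall _ _).segment_subset (Metric.mem_closedBall_self hε.le) ?_
      refine (hfδ _ m2 _ m1 ?_).le
      rw [Real.dist_eq]
      have : uniformNode a b n (j + 1) - uniformNode a b n j = h := by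
        simp only [uniformNode]; push_cast; ring
      rwa [this, abs_of_pos hpos]
    exact hsub hpj
  · rintro _ ⟨s, hs, rfl⟩
    set j := ⌊(s - a) / h⌋₊ with hj
    have hq0 : 0 ≤ (s - a) / h := div_nonneg (by linarith [hs.1]) hpos.le
    have h1 : (j : ℝ) ≤ (s - a) / h := Nat.floor_le hq0
    have h2 : (s - a) / h < j + 1 := Nat.lt_floor_add_one _
    have hjn : j ≤ n + 1 := by
      have : (s - a) / h ≤ n + 1 := by
        rw [div_le_iff₀ hpos, hh, mul_div_cancel₀ _ hn1.ne']
        linarith [hs.2]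
      exact_mod_cast h1.trans this
    refine ⟨_, graphPoint_mem_inscribedPolygon (Nat.succ_pos n) hjn, ?_⟩
    refine (hfδ _ hs _ (uniformNode_mem_Icc hab hjn) ?_).le
    rw [le_div_iff₀ hpos] at h1
    rw [div_lt_iff₀ hpos] at h2
    have : s - uniformNode a b n j = s - a - j * h := by simp only [uniformNode]; ring
    rw [Real.dist_eq, this, abs_lt]
    constructor <;> linarith

theorem tendsto_infDist_inscribedPolygon (hf : Continuous f) (hab : a < b)
    (x : EuclideanSpace ℝ (Fin 2)) :
    Tendsto (fun n => Metric.infDist x (inscribedPolygon f (uniformNode a b n) (n + 1))) atTop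
      (𝓝 (Metric.infDist x (graphPoint f '' Set.Icc a b))) := by
  rw [Metric.tendsto_nhds]
  intro ε hε
  filter_upwards [eventually_inscribedPolygon_close hf hab (half_pos hε)] with n hn
  have h1 := infDist_le_infDist_add
    ⟨_, graphPoint_mem_inscribedPolygon (f := f) (t := uniformNode a b n) (Nat.succ_pos n)
      (Nat.zero_le _)⟩ hn.1 x
  have h2 := infDist_le_infDist_add ((Set.nonempty_Icc.2 hab.le).image _) hn.2 x
  rw [Real.dist_eq, abs_lt]
  constructor <;> linarith

end Approximation

/-! ### The distance function of one graph -/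

section Graph

variable {g k f : ℝ → ℝ} {a b : ℝ}

/-- A convex function that stays convex after subtracting `|x 1 - f (x 0)|`, for `f = g - k`. -/
noncomputable def graphControl (g k : ℝ → ℝ) (x : EuclideanSpace ℝ (Fin 2)) : ℝ :=
  2 * max (x 1 + k (x 0)) (g (x 0))

theorem convexOn_comp_coord (hg : ConvexOn ℝ Set.univ g) (i : Fin 2) :
    ConvexOn ℝ Set.univ fun x : EuclideanSpace ℝ (Fin 2) => g (x i) := by
  simpa [Function.comp_def] using
    hg.comp_linearMap
      (EuclideanSpace.proj i : EuclideanSpace ℝ (Fin 2) →L[ℝ] ℝ).toLinearMap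

theorem convexOn_coord_add (hk : ConvexOn ℝ Set.univ k) :
    ConvexOn ℝ Set.univ fun x : EuclideanSpace ℝ (Fin 2) => x 1 + k (x 0) :=
  (convexOn_comp_coord (convexOn_id convex_univ) 1).add (convexOn_comp_coord hk 0)

theorem convexOn_graphControl (hg : ConvexOn ℝ Set.univ g) (hk : ConvexOn ℝ Set.univ k) :
    ConvexOn ℝ Set.univ (graphControl g k) := by
  have := ((convexOn_coord_add hk).sup (convexOn_comp_coord hg 0)).smul
    (zero_le_two (α := ℝ))
  exact this

theorem continuous_of_convexOn_univ {E : Type*} [NormedAddCommGroup E] [NormedSpace ℝ E]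
    [FiniteDimensional ℝ E] {φ : E → ℝ} (hφ : ConvexOn ℝ Set.univ φ) : Continuous φ :=
  continuousOn_univ.1 (hφ.continuousOn isOpen_univ)

/-- The corner control of the `n`-th equidistant polygon inscribed in the graph of `f`. -/
noncomputable def uniformCornerControl (f : ℝ → ℝ) (a b : ℝ) (n : ℕ) :
    EuclideanSpace ℝ (Fin 2) → ℝ :=
  cornerControl f (uniformNode a b n) (fun j =>
    2 * |slope f (uniformNode a b n (j + 1)) (uniformNode a b n (j + 2)) -
      slope f (uniformNode a b n j) (uniformNode a b n (j + 1))| + 1 / ((n : ℝ) + 1)) (n + 1)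

theorem convexOn_uniformCornerControl (n : ℕ) :
    ConvexOn ℝ Set.univ (uniformCornerControl f a b n) :=
  convexOn_cornerControl fun _ => by positivity

theorem exists_uniformCornerControl_bound (hg : ConvexOn ℝ Set.univ g)
    (hk : ConvexOn ℝ Set.univ k) (hf : ∀ x, f x = g x - k x) (hfc : Continuous f)
    (hab : a < b) : ∃ B : EuclideanSpace ℝ (Fin 2) → ℝ,
      ∀ n x, uniformCornerControl f a b n x ∈ Set.Icc 0 (B x) := by
  obtain ⟨R, hR⟩ := ((isCompact_Icc (a := a) (b := b)).image
    (continuous_graphPoint hfc)).isBounded.exists_norm_le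
  have hR' : ∀ s ∈ Set.Icc a b, ‖graphPoint f s‖ ≤ R := fun s hs => hR _ ⟨s, hs, rfl⟩
  set C := (slope g b (b + 1) - slope g (a - 1) a) + (slope k b (b + 1) - slope k (a - 1) a)
    with hC
  refine ⟨fun x => 2 * (2 * C + 1) * (‖x‖ + R), fun n x =>
    ⟨cornerControl_nonneg (fun _ => by positivity) x, ?_⟩⟩
  refine (cornerControl_le (R := R) (fun _ => by positivity) (Nat.succ_pos n)
    (fun j hj => hR' _ (uniformNode_mem_Icc hab hj)) x).trans ?_
  have hR0 : 0 ≤ R := (norm_nonneg _).trans (hR' a ⟨le_rfl, hab.le⟩)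
  beta_reduce
  gcongr
  rw [Finset.sum_add_distrib, ← Finset.mul_sum]
  have h1 := sum_abs_slope_diff_le (n := n) hg hk hf (strictMono_uniformNode hab n)
  rw [uniformNode_zero, uniformNode_last, ← hC] at h1
  -- The slack `1 / (n + 1)` keeps the lenses open around the needed directions; over `n` interior
  -- vertices it costs less than `1`.
  have h2 : ∑ _j ∈ Finset.range (n + 1 - 1), 1 / ((n : ℝ) + 1) ≤ 1 := by
    rw [Finset.sum_const, Finset.card_range, nsmul_eq_mul, Nat.add_sub_cancel, mul_one_div]
    exact div_le_one_of_le₀ (by linarith) (by positivity)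
  rw [Nat.add_sub_cancel] at h2
  rw [Nat.succ_sub_one]
  linarith

/-- Convexity on a fixed set survives a pointwise limit in `n`, whereas the increments allowed in
local midconvexity could shrink with `n`. -/
theorem convexOn_uniformCornerControl_sub_infDist (hab : a < b) {n : ℕ}
    {s : Set (EuclideanSpace ℝ (Fin 2))} (hs : Convex ℝ s)
    (hdisj : ∀ x ∈ s, x ∉ inscribedPolygon f (uniformNode a b n) (n + 1)) :
    ConvexOn ℝ s fun x => uniformCornerControl f a b n x + ‖x - graphPoint f a‖ +
      ‖x - graphPoint f b‖ -
        Metric.infDist x (inscribedPolygon f (uniformNode a b n) (n + 1)) := by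
  refine convexOn_of_locallyMidconvexAt hs ?_ fun x hx => ?_
  · have h1 := continuous_of_convexOn_univ (convexOn_uniformCornerControl (f := f) (a := a)
      (b := b) n)
    have h2 := Metric.continuous_infDist_pt (inscribedPolygon f (uniformNode a b n) (n + 1))
    exact Continuous.continuousOn (by fun_prop)
  · have := locallyMidconvexAt_off_inscribedPolygon (strictMono_uniformNode hab n)
      (Nat.succ_pos n) (r := fun j =>
    2 * |slope f (uniformNode a b n (j + 1)) (uniformNode a b n (j + 2)) -
      slope f (uniformNode a b n j) (uniformNode a b n (j + 1))| + 1 / ((n : ℝ) + 1))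
      (fun j => lt_add_of_pos_right _ (by positivity)) (hdisj x hx)
    rwa [uniformNode_zero, uniformNode_last] at this

/-- The distance function of a compact piece of the graph of a DC function is DC. -/
theorem exists_convexOn_sub_infDist_graph (hg : ConvexOn ℝ Set.univ g)
    (hk : ConvexOn ℝ Set.univ k) (hf : ∀ x, f x = g x - k x) (hab : a ≤ b) :
    ∃ H : EuclideanSpace ℝ (Fin 2) → ℝ, ConvexOn ℝ Set.univ H ∧
      ConvexOn ℝ Set.univ fun x => H x - Metric.infDist x (graphPoint f '' Set.Icc a b) := by
  rcases hab.eq_or_lt with rfl | hab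
  · refine ⟨fun x => ‖x - graphPoint f a‖, convexOn_norm_sub _, ?_⟩
    simpa [Metric.infDist_singleton, dist_eq_norm] using convexOn_const (0 : ℝ) convex_univ
  have hfc : Continuous f := by
    rw [funext hf]
    exact (continuous_of_convexOn_univ hg).sub (continuous_of_convexOn_univ hk)
  set P := graphPoint f '' Set.Icc a b with hP
  obtain ⟨B, hB⟩ := exists_uniformCornerControl_bound hg hk hf hfc hab
  obtain ⟨l, K, hl, hlt, hK⟩ := exists_filter_tendsto_pointwise hB
  have hKc : ConvexOn ℝ Set.univ K := convexOn_of_tendsto convex_univ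
    (Eventually.of_forall convexOn_uniformCornerControl) fun x _ => hK x
  have hMc := convexOn_graphControl hg hk
  have ha := convexOn_norm_sub (graphPoint f a)
  have hb := convexOn_norm_sub (graphPoint f b)
  have hle : ∀ s ∈ Set.Icc a b, ∀ y, Metric.infDist y P ≤ ‖y - graphPoint f s‖ :=
    fun s hs y => by
      rw [← dist_eq_norm]
      exact Metric.infDist_le_dist_of_mem ⟨s, hs, rfl⟩
  have hHc : ConvexOn ℝ Set.univ fun x => K x + ‖x - graphPoint f a‖ + ‖x - graphPoint f b‖ +
      graphControl g k x := ((hKc.add ha).add hb).add hMc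
  refine ⟨_, hHc, convexOn_of_locallyMidconvexAt convex_univ ?_ fun x _ => ?_⟩
  · exact ((continuous_of_convexOn_univ hHc).sub (Metric.continuous_infDist_pt P)).continuousOn
  have lK : LocallyMidconvexAt K x := .of_convexOn_univ hKc
  have lM : LocallyMidconvexAt (graphControl g k) x := .of_convexOn_univ hMc
  have la : LocallyMidconvexAt _ x := .of_convexOn_univ ha
  have lb : LocallyMidconvexAt _ x := .of_convexOn_univ hb
  by_cases hx : x ∈ P
  · have hx0 := Metric.infDist_zero_of_mem hx
    obtain ⟨s, hs, rfl⟩ := hx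
    -- At an endpoint, the norm centred there dominates the distance and both vanish at `x`.
    rcases hs.1.eq_or_lt with rfl | hsa
    · refine ((lK.add lb).add lM).of_touching (by rw [hx0]; simp)
        (Eventually.of_forall fun y => ?_)
      linarith [hle a hs y]
    rcases hs.2.eq_or_lt with rfl | hsb
    · refine ((lK.add la).add lM).of_touching (by rw [hx0]; simp)
        (Eventually.of_forall fun y => ?_)
      linarith [hle s hs y]
    have hM : ∀ y, graphControl g k y - |y 1 - f (y 0)| = (y 1 + k (y 0)) + g (y 0) :=
      fun y => by
        have e : y 1 - f (y 0) = (y 1 + k (y 0)) - g (y 0) := by rw [hf]; ring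
        rw [e, graphControl]
        rcases le_total (y 1 + k (y 0)) (g (y 0)) with h | h
        · rw [max_eq_right h, abs_of_nonpos (sub_nonpos.2 h)]; ring
        · rw [max_eq_left h, abs_of_nonneg (sub_nonneg.2 h)]; ring
    have lM' : LocallyMidconvexAt
        (fun y => graphControl g k y - |y 1 - f (y 0)|) (graphPoint f s) :=
      (LocallyMidconvexAt.of_convexOn_univ
        ((convexOn_coord_add hk).add (convexOn_comp_coord hg 0))).congr fun y => (hM y).symm
    refine (((lK.add la).add lb).add lM').of_touching ?_ ?_
    · simp only [hx0]
      simp [graphPoint]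
    · have hc : ContinuousAt (fun y : EuclideanSpace ℝ (Fin 2) => y 0) (graphPoint f s) := by
        fun_prop
      have hev : ∀ᶠ y in 𝓝 (graphPoint f s), y 0 ∈ Set.Ioo a b :=
        hc.eventually (isOpen_Ioo.mem_nhds (by simpa [graphPoint] using ⟨hsa, hsb⟩))
      filter_upwards [hev] with y hy
      have h1 := hle (y 0) ⟨hy.1.le, hy.2.le⟩ y
      have h2 : ‖y - graphPoint f (y 0)‖ = |y 1 - f (y 0)| := by
        rw [← Real.sqrt_sq (norm_nonneg _), norm_sq_plane]
        simp [graphPoint, Real.sqrt_sq_eq_abs]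
      linarith
  · have hPc : IsCompact P := isCompact_Icc.image (continuous_graphPoint hfc)
    have hPn : P.Nonempty := (Set.nonempty_Icc.2 hab.le).image _
    have hρ : 0 < Metric.infDist x P := (hPc.isClosed.notMem_iff_infDist_pos hPn).1 hx
    set ρ := Metric.infDist x P with hρdef
    -- Polygons within `ρ / 2` of `P` miss this ball, since `x` has distance `ρ` from `P`.
    have hconv : ConvexOn ℝ (Metric.ball x (ρ / 2)) fun y =>
        K y + ‖y - graphPoint f a‖ + ‖y - graphPoint f b‖ - Metric.infDist y P := by
      refine convexOn_of_tendsto (l := l) (convex_ball _ _) (φ := fun n y =>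
        uniformCornerControl f a b n y + ‖y - graphPoint f a‖ +
          ‖y - graphPoint f b‖ -
          Metric.infDist y (inscribedPolygon f (uniformNode a b n) (n + 1))) ?_ fun y _ => ?_
      · filter_upwards [hlt (eventually_inscribedPolygon_close hfc hab (half_pos hρ))] with n hn
        refine convexOn_uniformCornerControl_sub_infDist hab (convex_ball _ _) fun y hy hyp => ?_
        obtain ⟨q, hq, hyq⟩ := hn.1 y hyp
        have h1 : dist y x < ρ / 2 := hy
        have h2 := Metric.infDist_le_dist_of_mem (x := x) hq
        linarith [dist_triangle x y q, dist_comm x y]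
      · exact (((hK y).add tendsto_const_nhds).add tendsto_const_nhds).sub
          ((tendsto_infDist_inscribedPolygon hfc hab y).mono_left hlt)
    exact ((LocallyMidconvexAt.of_convexOn hconv (Metric.ball_mem_nhds x (half_pos hρ))).add
      lM).congr fun y => by ring

end Graph

/-! ### Locally finite unions -/

section Gluing

variable {E : Type*} [NormedAddCommGroup E] [NormedSpace ℝ E]

theorem convexOn_norm_sq_add_const (c : ℝ) : ConvexOn ℝ Set.univ fun x : E => ‖x‖ ^ 2 + c :=
  (convexOn_univ_norm.pow (fun _ _ => norm_nonneg _) 2).add_const c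

/-- A sequence of convex functions, the `n`-th of which vanishes on the ball of radius `n - 1`, has
a convex sum. -/
theorem exists_convexOn_sum_of_eq_zero {G : ℕ → E → ℝ} (hG : ∀ n, ConvexOn ℝ Set.univ (G n))
    (h0 : ∀ (n : ℕ) x, ‖x‖ + 1 ≤ n → G n x = 0) :
    ∃ T : E → ℝ, ConvexOn ℝ Set.univ T ∧
      ∀ (N : ℕ) x, ‖x‖ ≤ N → T x = ∑ n ∈ Finset.range (N + 1), G n x := by
  have key : ∀ (N : ℕ) x, ‖x‖ ≤ N →
      ∑ n ∈ Finset.range (⌈‖x‖⌉₊ + 1), G n x = ∑ n ∈ Finset.range (N + 1), G n x := by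
    intro N x hx
    refine Finset.sum_subset (Finset.range_mono ?_) fun n _ hn => h0 n x ?_
    · exact Nat.succ_le_succ (Nat.ceil_le.2 hx)
    · rw [Finset.mem_range, not_lt] at hn
      have h1 : ((⌈‖x‖⌉₊ + 1 : ℕ) : ℝ) ≤ n := by exact_mod_cast hn
      push_cast at h1
      linarith [Nat.le_ceil ‖x‖]
  refine ⟨fun x => ∑ n ∈ Finset.range (⌈‖x‖⌉₊ + 1), G n x,
    ⟨convex_univ, fun x _ y _ a b ha hb hab => ?_⟩, key⟩
  -- The truncation depends on the point; one `N` serves `x`, `y` and their combination because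
  -- balls are convex.
  set N := max ⌈‖x‖⌉₊ ⌈‖y‖⌉₊ with hN
  have hx : ‖x‖ ≤ N := (Nat.le_ceil _).trans (by exact_mod_cast le_max_left _ _)
  have hy : ‖y‖ ≤ N := (Nat.le_ceil _).trans (by exact_mod_cast le_max_right _ _)
  have hz : ‖a • x + b • y‖ ≤ N := by
    have := convex_closedBall (0 : E) (N : ℝ) (x := x) (by simpa using hx) (y := y)
      (by simpa using hy) ha hb hab
    simpa using this
  beta_reduce
  rw [key N x hx, key N y hy, key N _ hz]
  exact (convexOn_sum_univ fun n _ => hG n).2 (Set.mem_univ x) (Set.mem_univ y) ha hb hab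

variable [FiniteDimensional ℝ E]

/-- A convex function can be replaced by a convex function that vanishes on the ball of radius
`n - 1` and differs from it by a convex function around the points of norm in `[n, n + 1)`. -/
theorem exists_convexOn_cutoff {h : E → ℝ} (hh : ConvexOn ℝ Set.univ h) (n : ℕ) :
    ∃ G q : E → ℝ, ConvexOn ℝ Set.univ G ∧ ConvexOn ℝ Set.univ q ∧
      (∀ x, ‖x‖ + 1 ≤ n → G x = 0) ∧
      ∀ x, n ≤ ‖x‖ → ‖x‖ < n + 1 → ∀ᶠ y in 𝓝 x, G y = h y + q y := by
  have hc : Continuous h := continuous_of_convexOn_univ hh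
  obtain ⟨B, hB⟩ := (isCompact_closedBall (0 : E) (n + 1)).exists_bound_of_continuousOn
    hc.continuousOn
  have hB0 : 0 ≤ B := (norm_nonneg _).trans (hB 0 (by simp; positivity))
  have hB' : ∀ x, ‖x‖ ≤ n + 1 → |h x| ≤ B := fun x hx => hB x (by simpa using hx)
  -- The second factor is at most `-1/2` for `‖x‖ ≤ n - 1` and at least `1/2` for `‖x‖ ≥ n`, so `2 *
  -- B + 1` lets `q` outweigh `|h| ≤ B` and decides the sign of `h + q`.
  set q : E → ℝ := fun x => (2 * B + 1) * (‖x‖ ^ 2 + (1 / 2 - (n : ℝ) ^ 2)) with hq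
  have hqc : ConvexOn ℝ Set.univ q :=
    (convexOn_norm_sq_add_const _).smul (by positivity : 0 ≤ 2 * B + 1)
  have hqcont : Continuous q := continuous_of_convexOn_univ hqc
  refine ⟨fun x => max 0 (h x + q x), q,
    (convexOn_const 0 convex_univ).sup (hh.add hqc), hqc, fun x hx => ?_, fun x hx1 hx2 => ?_⟩
  · have h1 := (abs_le.1 (hB' x (by linarith))).2
    have h2 : ‖x‖ ^ 2 + (1 / 2 - (n : ℝ) ^ 2) ≤ -(1 / 2) := by
      nlinarith [norm_nonneg x]
    have h3 : q x ≤ (2 * B + 1) * -(1 / 2) := by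
      simp only [hq]; gcongr
    exact max_eq_left (by linarith)
  · have h1 := (abs_le.1 (hB' x hx2.le)).1
    have h2 : 1 / 2 ≤ ‖x‖ ^ 2 + (1 / 2 - (n : ℝ) ^ 2) := by
      have : (0 : ℝ) ≤ n := by positivity
      nlinarith
    have h3 : (2 * B + 1) * (1 / 2) ≤ q x := by
      simp only [hq]; gcongr
    have h4 : 0 < h x + q x := by linarith
    filter_upwards [continuousAt_const.eventually_lt (hc.add hqcont).continuousAt h4] with y hy
    exact max_eq_right hy.le

/-- DC distance functions are stable under locally finite unions of compact sets. -/
theorem exists_convexOn_sub_infDist_iUnion {ι : Type*} {P : ι → Set E}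
    (hcomp : ∀ i, IsCompact (P i)) (hfin : LocallyFinite P) (hne : (⋃ i, P i).Nonempty)
    (hdc : ∀ i, ∃ H : E → ℝ, ConvexOn ℝ Set.univ H ∧
      ConvexOn ℝ Set.univ fun x => H x - Metric.infDist x (P i)) :
    ∃ H : E → ℝ, ConvexOn ℝ Set.univ H ∧
      ConvexOn ℝ Set.univ fun x => H x - Metric.infDist x (⋃ i, P i) := by
  classical
  have : ProperSpace E := FiniteDimensional.proper_real E
  choose H hH hHd using hdc
  set A := ⋃ i, P i with hA
  have hAc : IsClosed A := hfin.isClosed_iUnion fun i => (hcomp i).isClosed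
  obtain ⟨a₀, ha₀⟩ := hne
  -- For `‖x‖ < n + 1` a nearest point of `A` has norm at most `2‖x‖ + ‖a₀‖`, so its piece is
  -- indexed in `I n`.
  set I : ℕ → Finset ι := fun n => (hfin.finite_nonempty_inter_compact
    (isCompact_closedBall (0 : E) (2 * (n + 1) + ‖a₀‖))).toFinset with hI
  have hsum : ∀ s : Finset ι, ConvexOn ℝ Set.univ fun x => ∑ i ∈ s, H i x :=
    fun s => convexOn_sum_univ fun i _ => hH i
  choose G q hG hq hG0 hGq using fun n => exists_convexOn_cutoff (hsum (I n)) n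
  obtain ⟨T, hT, hTsum⟩ := exists_convexOn_sum_of_eq_zero hG hG0
  refine ⟨T, hT, convexOn_of_locallyMidconvexAt convex_univ
    ((continuous_of_convexOn_univ hT).sub (Metric.continuous_infDist_pt A)).continuousOn
    fun x _ => ?_⟩
  set n := ⌊‖x‖⌋₊ with hn
  have hn1 : (n : ℝ) ≤ ‖x‖ := Nat.floor_le (norm_nonneg x)
  have hn2 : ‖x‖ < n + 1 := Nat.lt_floor_add_one _
  obtain ⟨p, hpA, hpd⟩ := hAc.exists_infDist_eq_dist ⟨a₀, ha₀⟩ x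
  obtain ⟨i, hpi⟩ := Set.mem_iUnion.1 hpA
  have hpn : ‖p‖ ≤ 2 * (n + 1) + ‖a₀‖ := by
    have h1 : dist x p ≤ dist x a₀ := hpd ▸ Metric.infDist_le_dist_of_mem ha₀
    have h2 : dist x a₀ ≤ ‖x‖ + ‖a₀‖ := dist_le_norm_add_norm _ _
    have h3 : ‖p‖ ≤ ‖x‖ + dist x p := by
      rw [dist_eq_norm, ← norm_neg (x - p), neg_sub]
      exact norm_le_norm_add_norm_sub' p x
    linarith
  have hi : i ∈ I n := by
    rw [hI, Set.Finite.mem_toFinset]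
    exact ⟨p, hpi, by simpa using hpn⟩
  have hle : ∀ y, Metric.infDist y A ≤ Metric.infDist y (P i) := fun y =>
    Metric.infDist_le_infDist_of_subset (Set.subset_iUnion P i) ⟨p, hpi⟩
  have heq : Metric.infDist x A = Metric.infDist x (P i) :=
    le_antisymm (hle x) (hpd ▸ Metric.infDist_le_dist_of_mem hpi)
  have hmem : n ∈ Finset.range (n + 1 + 1) := Finset.mem_range.2 (by omega)
  -- Near `x` the summand `G n` contains `H i`, which compensates the distance to `P i`; everything
  -- else in `T` is convex.
  have hlocal : ∀ᶠ y in 𝓝 x,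
      (H i y - Metric.infDist y (P i)) + ∑ j ∈ (I n).erase i, H j y + q n y +
        ∑ m ∈ (Finset.range (n + 1 + 1)).erase n, G m y = T y - Metric.infDist y (P i) := by
    have hev : ∀ᶠ y in 𝓝 x, ‖y‖ < n + 1 :=
      continuous_norm.continuousAt.eventually_lt continuousAt_const hn2
    filter_upwards [hev, hGq n x hn1 hn2] with y h1 h2
    rw [hTsum (n + 1) y (by push_cast; exact h1.le), ← Finset.add_sum_erase _ _ hmem, h2,
      ← Finset.add_sum_erase _ _ hi]
    ring
  have hconv : LocallyMidconvexAt (fun y =>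
      (H i y - Metric.infDist y (P i)) + ∑ j ∈ (I n).erase i, H j y + q n y +
        ∑ m ∈ (Finset.range (n + 1 + 1)).erase n, G m y) x :=
    .of_convexOn_univ ((((hHd i).add (hsum _)).add (hq n)).add
      (convexOn_sum_univ fun m _ => hG m))
  refine hconv.of_touching ?_ ?_
  · rw [hlocal.self_of_nhds, heq]
  · filter_upwards [hlocal] with y hy
    rw [hy]
    linarith [hle y]

end Gluing

/-! ### Invariance under rotations -/

section Rotation

/-- The rotation by `θ` as a linear isometry. -/
noncomputable def planarRotationIsometry (θ : ℝ) :
    EuclideanSpace ℝ (Fin 2) →ₗᵢ[ℝ] EuclideanSpace ℝ (Fin 2) where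
  toFun := planarRotation θ
  map_add' x y := by ext i; fin_cases i <;> simp [planarRotation] <;> ring
  map_smul' c x := by ext i; fin_cases i <;> simp [planarRotation] <;> ring
  norm_map' x := by
    refine (sq_eq_sq₀ (norm_nonneg _) (norm_nonneg _)).1 ?_
    rw [norm_sq_plane, norm_sq_plane]
    simp [planarRotation]
    linear_combination (x 0 ^ 2 + x 1 ^ 2) * Real.sin_sq_add_cos_sq θ

theorem planarRotation_planarRotation_neg (θ : ℝ) (x : EuclideanSpace ℝ (Fin 2)) :
    planarRotation θ (planarRotation (-θ) x) = x := by
  ext i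
  fin_cases i
  · simp [planarRotation]
    linear_combination x 0 * Real.sin_sq_add_cos_sq θ
  · simp [planarRotation]
    linear_combination x 1 * Real.sin_sq_add_cos_sq θ

theorem planarGraphOn_eq_image (f : ℝ → ℝ) (I : Set ℝ) :
    planarGraphOn f I = graphPoint f '' I := by
  ext p
  constructor
  · rintro ⟨h0, h1⟩
    refine ⟨p 0, h0, ?_⟩
    ext i
    fin_cases i
    · rfl
    · exact h1.symm
  · rintro ⟨s, hs, rfl⟩
    exact ⟨hs, rfl⟩

theorem infDist_planarRotation_image (θ : ℝ) (x : EuclideanSpace ℝ (Fin 2))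
    (S : Set (EuclideanSpace ℝ (Fin 2))) :
    Metric.infDist x (planarRotation θ '' S) = Metric.infDist (planarRotation (-θ) x) S := by
  conv_lhs => rw [← planarRotation_planarRotation_neg θ x]
  exact Metric.infDist_image (planarRotationIsometry θ).isometry

theorem convexOn_comp_planarRotation {φ : EuclideanSpace ℝ (Fin 2) → ℝ}
    (hφ : ConvexOn ℝ Set.univ φ) (θ : ℝ) :
    ConvexOn ℝ Set.univ fun x => φ (planarRotation θ x) :=
  hφ.comp_linearMap (planarRotationIsometry θ).toLinearMap

theorem IsDCGraph.isCompact {P : Set (EuclideanSpace ℝ (Fin 2))} (hP : IsDCGraph P) :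
    IsCompact P := by
  obtain ⟨f, a, b, θ, ⟨g, k, hg, hk, hf⟩, -, rfl⟩ := hP
  have hfc : Continuous f := by
    rw [funext hf]
    exact (continuous_of_convexOn_univ hg).sub (continuous_of_convexOn_univ hk)
  rw [planarGraphOn_eq_image]
  exact (isCompact_Icc.image (continuous_graphPoint hfc)).image
    (planarRotationIsometry θ).continuous

theorem IsDCGraph.exists_convexOn_sub_infDist {P : Set (EuclideanSpace ℝ (Fin 2))}
    (hP : IsDCGraph P) : ∃ H : EuclideanSpace ℝ (Fin 2) → ℝ, ConvexOn ℝ Set.univ H ∧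
      ConvexOn ℝ Set.univ fun x => H x - Metric.infDist x P := by
  obtain ⟨f, a, b, θ, ⟨g, k, hg, hk, hf⟩, hab, rfl⟩ := hP
  obtain ⟨H, hH, hHd⟩ := exists_convexOn_sub_infDist_graph hg hk hf hab
  refine ⟨fun x => H (planarRotation (-θ) x), convexOn_comp_planarRotation hH _, ?_⟩
  simp only [infDist_planarRotation_image, planarGraphOn_eq_image]
  exact convexOn_comp_planarRotation hHd (-θ)

end Rotation

/-! ### Conclusion -/

theorem proposition4p9 {ι : Type*} (P : ι → Set (EuclideanSpace ℝ (Fin 2)))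
    (hP : ∀ i, IsDCGraph (P i)) (hfin : LocallyFinite P)
    (A : Set (EuclideanSpace ℝ (Fin 2))) (hA : A = ⋃ i, P i) :
    A ∈ dcDistanceSets 2 := by
  subst hA
  rcases (⋃ i, P i).eq_empty_or_nonempty with h | h
  · exact Or.inl h
  · obtain ⟨H, hH, hHd⟩ := exists_convexOn_sub_infDist_iUnion (fun i => (hP i).isCompact) hfin h
      fun i => (hP i).exists_convexOn_sub_infDist
    exact Or.inr ⟨h, hfin.isClosed_iUnion fun i => (hP i).isCompact.isClosed,
      isDC_of_convexOn_sub hH hHd⟩
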